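/- Let $k$ be a field, let $G$ be a finite simple graph on $V(G)=[n]=\{1,\dots,n\}$ with edge set $E(G)$, and for $d\ge 1$ let $$\hat L_G(d)=\Big(\sum_{\ell=1}^{d}\big(x_{i,2\ell-1}x_{j,2\ell}-x_{i,2\ell}x_{j,2\ell-1}\big)\ :\ \{i,j\}\in E(G),\ i<j\Big)\subseteq k[x_{ij}\mid i\in[n],\,j\in[2d]]$$ be the twisted Lovász–Saks–Schrijver ideal of $G$. For an integer $p\ge 1$, a *twisted matching decomposition* of $G$ is a partition $E(G)=M_1\cup\dots\cup M_{2p}$ into pairwise disjoint (possibly empty) matchings such that for all $q=1,\dots,p$ and all $\{i,j\}\in M_{2q-1}$ with $i<j$, no edge $\{k_1,i\}$ with $k_1<i$ and no edge $\{j,k_2\}$ with $j<k_2$ belongs to $M_{2q}$. Let $H_q$ be the graph with vertices $1_{2q-1},\dots,n_{2q-1},1_{2q},\dots,n_{2q}$ whose edges are, for $i<j$, the pairs $\{i_{2q-1},j_{2q}\}$ with $\{i,j\}\in M_{2q-1}$ and the pairs $\{j_{2q-1},i_{2q}\}$ with $\{i,j\}\in M_{2q}$. A *twisted positive mapping* on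 $H_q$ is a function $w:V(H_q)\to\mathbb R$ such that for all $i\ne j$ in $[n]$: * if $\{i_{2q-1},j_{2q}\}\in E(H_q)$, then $w(i_{2q-1})+w(j_{2q})>0$ and $w(j_{2q-1})+w(i_{2q})<0$; * if $\{i,j\}\in E(G)\setminus\bigcup_{1\le m\le 2(q-1)}M_m$ and neither $\{i_{2q-1},j_{2q}\}$ nor $\{j_{2q-1},i_{2q}\}$ is an edge of $H_q$, then $w(i_{2q-1})+w(j_{2q})<0$ and $w(j_{2q-1})+w(i_{2q})<0$. The number $\operatorname{tpmd}(G)$ is the smallest $p\ge1$ for which $G$ has a twisted matching decomposition $M_1,\dots,M_{2p}$ such that each of $H_1,\dots,H_p$ has a twisted positive mapping. **Theorem.** If $d\ge\operatorname{tpmd}(G)$, then $\hat L_G(d)$ is a radical ideal and a complete intersection, that is, its minimal number of generators equals its height. -/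

import Mathlib

namespace TwistedLSS

/-- The index `2q - 1` of the `q`-th consecutive pair `(2q - 1, 2q)` in `{1, …, 2p}`.
Everything is counted from `0` here: `q = 0, …, p - 1` and the pair is `(2q, 2q + 1)`. -/
def oddIdx {p : ℕ} (q : Fin p) : Fin (2 * p) := ⟨2 * q.val, by omega⟩

/-- The index `2q` of the `q`-th consecutive pair `(2q - 1, 2q)` in `{1, …, 2p}`,
counted from `0`. -/
def evenIdx {p : ℕ} (q : Fin p) : Fin (2 * p) := ⟨2 * q.val + 1, by omega⟩

/-! ### Twisted LSS-ideals and complete intersections -/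

/-- The polynomial `∑ ℓ, x_{i,2ℓ-1} x_{j,2ℓ} - x_{i,2ℓ} x_{j,2ℓ-1}` in the polynomial ring
on the variables `x_{ij}`, `i ∈ [n]`, `j ∈ [2d]`. -/
noncomputable def twistedGen (k : Type*) [Field k] {n : ℕ} (d : ℕ) (i j : Fin n) :
    MvPolynomial (Fin n × Fin (2 * d)) k :=
  ∑ l : Fin d,
    (MvPolynomial.X (i, oddIdx l) * MvPolynomial.X (j, evenIdx l)
      - MvPolynomial.X (i, evenIdx l) * MvPolynomial.X (j, oddIdx l))

/-- The twisted Lovász-Saks-Schrijver ideal of a graph on `[n]`; every edge `{i, j}` is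
written with `i < j`. -/
noncomputable def twistedLSSIdeal (k : Type*) [Field k] {n : ℕ} (G : SimpleGraph (Fin n))
    (d : ℕ) : Ideal (MvPolynomial (Fin n × Fin (2 * d)) k) :=
  Ideal.span {f | ∃ i j : Fin n, i < j ∧ G.Adj i j ∧ f = twistedGen k d i j}

/-- An ideal is a complete intersection if its minimal number of generators equals its
height. -/
def IsCompleteIntersection {R : Type*} [CommRing R] (I : Ideal R) : Prop :=
  I.FG ∧ (Submodule.spanFinrank I : ℕ∞) = I.height

/-! ### Twisted positive matching decompositions -/

/-- A set of edges is a matching if its members are pairwise disjoint. -/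
def IsEdgeMatching {V : Type*} (M : Set (Sym2 V)) : Prop :=
  M.Pairwise fun e f => ∀ v, v ∈ e → v ∉ f

/-- A twisted matching decomposition of `G`: a partition of the edge set into `2p` (possibly
empty) matchings `M_1, …, M_{2p}` such that, for `{i, j} ∈ M_{2q-1}` with `i < j`, no edge
`{k, i}` with `k < i` and no edge `{j, k}` with `j < k` lies in `M_{2q}`. -/
structure IsTwistedMatchingDecomposition {n p : ℕ} (G : SimpleGraph (Fin n))
    (M : Fin (2 * p) → Set (Sym2 (Fin n))) : Prop where
  matching : ∀ l, IsEdgeMatching (M l)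
  disjoint : ∀ l m, l ≠ m → Disjoint (M l) (M m)
  union : ⋃ l, M l = G.edgeSet
  twisted : ∀ (q : Fin p) (i j : Fin n), i < j → s(i, j) ∈ M (oddIdx q) →
    (∀ k, k < i → s(k, i) ∉ M (evenIdx q)) ∧ (∀ k, j < k → s(j, k) ∉ M (evenIdx q))

/-- The graph `H_q` of the pair `(M_{2q-1}, M_{2q})`. The vertex `i_{2q-1}` is `Sum.inl i` and
the vertex `i_{2q}` is `Sum.inr i`. For `i < j`, an edge `{i, j}` of `M_{2q-1}` gives the edge
`{i_{2q-1}, j_{2q}}`, and an edge `{i, j}` of `M_{2q}` gives the edge `{j_{2q-1}, i_{2q}}`. -/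
def pairGraph {n p : ℕ} (M : Fin (2 * p) → Set (Sym2 (Fin n))) (q : Fin p) :
    SimpleGraph (Fin n ⊕ Fin n) :=
  SimpleGraph.fromEdgeSet {e | ∃ i j : Fin n, i < j ∧
    ((s(i, j) ∈ M (oddIdx q) ∧ e = s(Sum.inl i, Sum.inr j)) ∨
      (s(i, j) ∈ M (evenIdx q) ∧ e = s(Sum.inl j, Sum.inr i)))}

/-- A twisted positive mapping on `H_q`. The second condition concerns the edges of `G` that
lie in none of `M_1, …, M_{2(q-1)}` and do not give an edge of `H_q`. -/
structure IsTwistedPositiveMapping {n p : ℕ} (G : SimpleGraph (Fin n))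
    (M : Fin (2 * p) → Set (Sym2 (Fin n))) (q : Fin p) (w : Fin n ⊕ Fin n → ℝ) : Prop where
  pos : ∀ i j : Fin n, i ≠ j → (pairGraph M q).Adj (Sum.inl i) (Sum.inr j) →
    0 < w (Sum.inl i) + w (Sum.inr j) ∧ w (Sum.inl j) + w (Sum.inr i) < 0
  neg : ∀ i j : Fin n, i ≠ j → s(i, j) ∈ G.edgeSet →
    (∀ l : Fin (2 * p), l < oddIdx q → s(i, j) ∉ M l) →
    ¬ (pairGraph M q).Adj (Sum.inl i) (Sum.inr j) →
    ¬ (pairGraph M q).Adj (Sum.inl j) (Sum.inr i) →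
    w (Sum.inl i) + w (Sum.inr j) < 0 ∧ w (Sum.inl j) + w (Sum.inr i) < 0

/-- `G` admits a twisted positive matching decomposition with `p` parts, that is, with `p`
pairs `(M_{2q-1}, M_{2q})`. -/
def AdmitsTPMDecomposition {n : ℕ} (G : SimpleGraph (Fin n)) (p : ℕ) : Prop :=
  ∃ M : Fin (2 * p) → Set (Sym2 (Fin n)), IsTwistedMatchingDecomposition G M ∧
    ∀ q : Fin p, ∃ w : Fin n ⊕ Fin n → ℝ, IsTwistedPositiveMapping G M q w

/-- The twisted positive matching decomposition number: the smallest positive `p` for which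
`G` admits a twisted positive matching decomposition with `p` parts. -/
noncomputable def tpmd {n : ℕ} (G : SimpleGraph (Fin n)) : ℕ :=
  sInf {p : ℕ | 0 < p ∧ AdmitsTPMDecomposition G p}

theorem pairGraph_adj_inl_inr {n p : ℕ} (M : Fin (2 * p) → Set (Sym2 (Fin n))) (q : Fin p)
    (i j : Fin n) : (pairGraph M q).Adj (Sum.inl i) (Sum.inr j) ↔
      (i < j ∧ s(i, j) ∈ M (oddIdx q)) ∨ (j < i ∧ s(i, j) ∈ M (evenIdx q)) := by
  simp only [pairGraph, SimpleGraph.fromEdgeSet_adj, Set.mem_ofPred_eq]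
  constructor
  · rintro ⟨⟨a, b, hab, ⟨h, he⟩ | ⟨h, he⟩⟩, -⟩
    · simp at he
      obtain ⟨rfl, rfl⟩ := he
      exact Or.inl ⟨hab, h⟩
    · simp at he
      obtain ⟨rfl, rfl⟩ := he
      exact Or.inr ⟨hab, by rwa [Sym2.eq_swap]⟩
  · rintro (⟨h, hM⟩ | ⟨h, hM⟩)
    · exact ⟨⟨i, j, h, Or.inl ⟨hM, rfl⟩⟩, by simp⟩
    · exact ⟨⟨j, i, h, Or.inr ⟨by rwa [Sym2.eq_swap], rfl⟩⟩, by simp⟩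

/-- Every graph admits a twisted positive matching decomposition (one edge per pair), so that
the infimum defining `tpmd` is a minimum. -/
theorem exists_admitsTPMDecomposition {n : ℕ} (G : SimpleGraph (Fin n)) :
    ∃ p : ℕ, 0 < p ∧ AdmitsTPMDecomposition G p := by
  classical
  let φ : G.edgeSet ≃ Fin (Nat.card G.edgeSet) := Finite.equivFin _
  refine ⟨Nat.card G.edgeSet + 1, by omega,
    fun l => {e | ∃ h : e ∈ G.edgeSet, l.val = 2 * (φ ⟨e, h⟩).val}, ?_, ?_⟩
  · have hsub : ∀ (l : Fin (2 * (Nat.card G.edgeSet + 1))) (e f : Sym2 (Fin n)),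
        (∃ h : e ∈ G.edgeSet, l.val = 2 * (φ ⟨e, h⟩).val) →
        (∃ h : f ∈ G.edgeSet, l.val = 2 * (φ ⟨f, h⟩).val) → e = f := by
      rintro l e f ⟨he, h1⟩ ⟨hf, h2⟩
      have : φ ⟨e, he⟩ = φ ⟨f, hf⟩ := Fin.ext (by omega)
      exact congrArg Subtype.val (φ.injective this)
    refine ⟨fun l e he f hf hne => absurd (hsub l e f he hf) hne, ?_, ?_, ?_⟩
    · intro l m hlm
      rw [Set.disjoint_left]
      rintro e ⟨h, h1⟩ ⟨_, h2⟩
      exact hlm (Fin.ext (h1.trans h2.symm))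
    · ext e
      simp only [Set.mem_iUnion, Set.mem_ofPred_eq]
      exact ⟨fun ⟨_, h, _⟩ => h, fun h => ⟨⟨2 * (φ ⟨e, h⟩).val, by omega⟩, h, rfl⟩⟩
    · intro q i j _ _
      refine ⟨fun k _ hk => ?_, fun k _ hk => ?_⟩ <;>
      · obtain ⟨_, h⟩ := hk
        simp only [evenIdx] at h
        omega
  · intro q
    set M : Fin (2 * (Nat.card G.edgeSet + 1)) → Set (Sym2 (Fin n)) :=
      fun l => {e | ∃ h : e ∈ G.edgeSet, l.val = 2 * (φ ⟨e, h⟩).val} with hM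
    have hsub : ∀ e f, e ∈ M (oddIdx q) → f ∈ M (oddIdx q) → e = f := by
      rintro e f ⟨he, h1⟩ ⟨hf, h2⟩
      have : φ ⟨e, he⟩ = φ ⟨f, hf⟩ := Fin.ext (by omega)
      exact congrArg Subtype.val (φ.injective this)
    have hev : ∀ e, e ∉ M (evenIdx q) := by
      rintro e ⟨_, h⟩
      simp only [evenIdx] at h
      omega
    let w : Fin n ⊕ Fin n → ℝ := Sum.elim
      (fun i => if ∃ j, i < j ∧ s(i, j) ∈ M (oddIdx q) then 1 else -3)
      (fun j => if ∃ i, i < j ∧ s(i, j) ∈ M (oddIdx q) then 1 else -3)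
    have hneg : ∀ i j, ¬ (pairGraph M q).Adj (Sum.inl i) (Sum.inr j) →
        w (Sum.inl i) + w (Sum.inr j) < 0 := by
      intro i j hij
      simp only [w, Sum.elim_inl, Sum.elim_inr]
      split_ifs with h1 h2 h2
      · exfalso
        obtain ⟨b, hb, h1⟩ := h1
        obtain ⟨a, ha, h2⟩ := h2
        have := hsub _ _ h1 h2
        rw [Sym2.eq_iff] at this
        rcases this with ⟨rfl, rfl⟩ | ⟨rfl, rfl⟩
        · exact hij ((pairGraph_adj_inl_inr M q _ _).2 (Or.inl ⟨ha, h2⟩))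
        · exact lt_asymm ha hb
      all_goals norm_num
    refine ⟨w, fun i j hij h => ?_, fun i j _ _ _ h1 h2 => ⟨hneg _ _ h1, hneg _ _ h2⟩⟩
    rw [pairGraph_adj_inl_inr] at h
    rcases h with ⟨hlt, h⟩ | ⟨_, h⟩
    · refine ⟨?_, hneg _ _ ?_⟩
      · have h1 : ∃ j, i < j ∧ s(i, j) ∈ M (oddIdx q) := ⟨j, hlt, h⟩
        have h2 : ∃ i, i < j ∧ s(i, j) ∈ M (oddIdx q) := ⟨i, hlt, h⟩
        simp only [w, Sum.elim_inl, Sum.elim_inr, if_pos h1, if_pos h2]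
        norm_num
      · rw [pairGraph_adj_inl_inr]
        rintro (⟨h', _⟩ | ⟨_, h'⟩)
        · exact lt_asymm hlt h'
        · exact hev _ h'
    · exact absurd h (hev _)

end TwistedLSS

/-!
The generators of the twisted Lovász-Saks-Schrijver ideal form a Gröbner basis whose leading
monomials are squarefree and pairwise coprime, for a monomial order read off from the
decomposition.

The order (`TwistedLSS.decompositionOrder`) compares total degrees, then the vectors of weights
`(w_1, …, w_p)` lexicographically, where the positive mapping `w_q` weighs the variables of the
columns `2q - 1` and `2q` and every other variable has `q`-th weight `0`. For an edge of `G` lying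
in the `q`-th pair of matchings, all monomials of its generator from earlier columns have negative
weight at their own pair, and among the remaining ones only the monomial given by the edge of `H_q`
has positive `q`-th weight. So that monomial is leading (`TwistedLSS.degree_twistedGen`). The
matching and twisted conditions imply that every `H_q` has maximal degree at most one, so that the
leading monomials of different generators share no variable.

For polynomials with pairwise coprime leading monomials, every nonzero element of the ideal has a
leading monomial divisible by one of theirs
(`MonomialOrder.exists_degree_le_of_mem_span_image`). Hence:

* the generators are a regular sequence (`MonomialOrder.mem_span_image_of_mul_mem`); each of them
  raises the height by one, so that the height is at least their number, and Krull's height theorem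
  gives equality with the minimal number of generators;
* if the leading monomials are squarefree, the ideal is radical
  (`MonomialOrder.isRadical_span_image`): a nonzero polynomial reduced modulo the basis has no power
  in the ideal.
-/

/-! ### Heights and nonzerodivisors -/

namespace Ideal

/-- Adjoining an element that is a nonzerodivisor modulo `I` raises the height: such an element
lies in no minimal prime of `I`. -/
theorem height_add_one_le_height_sup_span_singleton {R : Type*} [CommRing R] {I : Ideal R} {x : R}
    (hx : ∀ y, x * y ∈ I → y ∈ I) : I.height + 1 ≤ (I ⊔ Ideal.span {x}).height := by
  rw [(I ⊔ Ideal.span {x}).height_eq_inf_minimalPrimes]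
  refine le_iInf₂ fun P hP => ?_
  have hPp := hP.isPrime
  have hPle : I ⊔ Ideal.span {x} ≤ P := hP.1.2
  obtain ⟨Q, hQ, hQP⟩ := Ideal.exists_minimalPrimes_le (le_sup_left.trans hPle)
  have hQp := hQ.isPrime
  have hxP : x ∈ P := hPle (Ideal.mem_sup_right (Ideal.mem_span_singleton_self x))
  have hxQ : x ∉ Q := by
    intro hxQ
    obtain ⟨y, hy, hxy⟩ := Ideal.exists_mul_mem_of_mem_minimalPrimes hQ hxQ
    exact hy (hx y hxy)
  have hlt : Q < P := lt_of_le_of_ne hQP fun h => hxQ (h ▸ hxP)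
  calc I.height + 1 ≤ Q.height + 1 := by gcongr; exact hQ.1.2
    _ ≤ P.height := Ideal.height_add_one_le_of_lt_of_isPrime hlt

end Ideal

/-! ### Polynomials with coprime leading monomials -/

theorem Finsupp.le_of_le_add_of_disjoint {σ : Type*} {a b c : σ →₀ ℕ} (hd : Disjoint a b)
    (h : a ≤ b + c) : a ≤ c := by
  intro s
  have h1 := h s
  have h2 : min (a s) (b s) = 0 := by
    exact DFunLike.congr_fun (_root_.disjoint_iff.1 hd) s
  simp only [Finsupp.add_apply] at h1
  omega

namespace MonomialOrder

open MvPolynomial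

section Field

variable {σ ι k : Type*} [Field k] (m : MonomialOrder σ) {f : ι → MvPolynomial σ k}

/-- Every polynomial is congruent to its remainder under multivariate division by the `f i`. -/
theorem exists_sub_mem_span_image (hf : ∀ i, f i ≠ 0) (S : Set ι) (g : MvPolynomial σ k) :
    ∃ r, g - r ∈ Ideal.span (f '' S) ∧
      ∀ c ∈ r.support, ∀ i ∈ S, ¬ m.degree (f i) ≤ c := by
  obtain ⟨q, r, hg, -, hr⟩ := m.div_set (B := f '' S)
    (by rintro _ ⟨i, -, rfl⟩; exact m.isUnit_leadingCoeff.2 (hf i)) g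
  refine ⟨r, ?_, fun c hc i hi => hr c hc _ ⟨i, hi, rfl⟩⟩
  rw [hg, add_sub_cancel_right, Finsupp.linearCombination_apply]
  exact Ideal.sum_mem _ fun b _ => Ideal.mul_mem_left _ _ (Ideal.subset_span b.2)

/-- Polynomials with pairwise coprime leading monomials form a Gröbner basis of the ideal they
generate. -/
theorem exists_degree_le_of_mem_span_image (hf : ∀ i, f i ≠ 0)
    (hd : Pairwise fun i j => Disjoint (m.degree (f i)) (m.degree (f j)))
    (S : Finset ι) {g : MvPolynomial σ k} (hg : g ∈ Ideal.span (f '' S)) (hg0 : g ≠ 0) :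
    ∃ i ∈ S, m.degree (f i) ≤ m.degree g := by
  classical
  induction S using Finset.induction_on generalizing g with
  | empty => simp at hg; exact absurd hg hg0
  | insert j S hj ih =>
    rw [Finset.coe_insert, Set.image_insert_eq, Ideal.mem_span_insert'] at hg
    obtain ⟨a, ha⟩ := hg
    -- Reduce the coefficient of `f j` modulo the other generators.
    obtain ⟨r, har, hr⟩ := m.exists_sub_mem_span_image hf S (-a)
    set h := g - f j * r with hh
    have hmem : h ∈ Ideal.span (f '' S) := by
      have : h = (g + a * f j) + (-a - r) * f j := by rw [hh]; ring
      rw [this]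
      exact add_mem ha (Ideal.mul_mem_right _ _ har)
    have hgh : g = f j * r + h := by rw [hh]; ring
    rcases eq_or_ne r 0 with rfl | hr0
    · rw [mul_zero, zero_add] at hgh
      obtain ⟨i, hi, hle⟩ := ih (hgh ▸ hmem) hg0
      exact ⟨i, Finset.mem_insert_of_mem hi, hle⟩
    have hdeg : m.degree (f j * r) = m.degree (f j) + m.degree r := m.degree_mul (hf j) hr0
    rcases eq_or_ne h 0 with h0 | h0
    · rw [h0, add_zero] at hgh
      exact ⟨j, Finset.mem_insert_self _ _, by rw [hgh, hdeg]; exact le_self_add⟩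
    obtain ⟨i, hi, hle⟩ := ih hmem h0
    have hij : i ≠ j := fun h => hj (h ▸ hi)
    -- No cancellation: the leading monomial of `h` is divisible by that of `f i`, but the leading
    -- monomial of `f j * r` is not.
    have hne : m.degree (f j * r) ≠ m.degree h := by
      intro he
      rw [← he, hdeg] at hle
      exact hr _ (m.degree_mem_support hr0) i hi
        (Finsupp.le_of_le_add_of_disjoint (hd hij) hle)
    rcases lt_or_gt_of_ne (m.toSyn.injective.ne hne) with hlt | hlt
    · refine ⟨i, Finset.mem_insert_of_mem hi, ?_⟩
      rwa [hgh, m.degree_add_eq_right_of_lt hlt]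
    · refine ⟨j, Finset.mem_insert_self _ _, ?_⟩
      rw [hgh, m.degree_add_of_lt hlt, hdeg]
      exact le_self_add

/-- Polynomials with pairwise coprime leading monomials form a regular sequence, in any order. -/
theorem mem_span_image_of_mul_mem (hf : ∀ i, f i ≠ 0)
    (hd : Pairwise fun i j => Disjoint (m.degree (f i)) (m.degree (f j)))
    (S : Finset ι) {j : ι} (hj : j ∉ S) {g : MvPolynomial σ k}
    (hg : f j * g ∈ Ideal.span (f '' S)) : g ∈ Ideal.span (f '' S) := by
  obtain ⟨r, hgr, hr⟩ := m.exists_sub_mem_span_image hf S g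
  have hr' : f j * r ∈ Ideal.span (f '' S) := by
    have := sub_mem hg (Ideal.mul_mem_left _ (f j) hgr)
    rwa [← mul_sub, sub_sub_cancel] at this
  rcases eq_or_ne r 0 with rfl | hr0
  · simpa using hgr
  obtain ⟨i, hi, hle⟩ :=
    m.exists_degree_le_of_mem_span_image hf hd S hr' (mul_ne_zero (hf j) hr0)
  have hij : i ≠ j := fun h => hj (h ▸ hi)
  rw [m.degree_mul (hf j) hr0] at hle
  exact absurd (Finsupp.le_of_le_add_of_disjoint (hd hij) hle)
    (hr _ (m.degree_mem_support hr0) i hi)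

theorem card_le_height_span_image (hf : ∀ i, f i ≠ 0)
    (hd : Pairwise fun i j => Disjoint (m.degree (f i)) (m.degree (f j)))
    (S : Finset ι) : (S.card : ℕ∞) ≤ (Ideal.span (f '' S)).height := by
  classical
  induction S using Finset.induction_on with
  | empty => simp
  | insert j S hj ih =>
    rw [Finset.card_insert_of_notMem hj, Finset.coe_insert, Set.image_insert_eq, Ideal.span_insert,
      sup_comm]
    push_cast
    exact (add_le_add_left ih 1).trans (Ideal.height_add_one_le_height_sup_span_singleton
      fun y hy => m.mem_span_image_of_mul_mem hf hd S hj hy)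

/-- The leading monomial of a power of `r` is the corresponding power of that of `r`, and a
squarefree monomial dividing it already divides the leading monomial of `r`. So no power of a
nonzero remainder under division by the `f i` lies in the ideal. -/
theorem isRadical_span_image (hf : ∀ i, f i ≠ 0)
    (hd : Pairwise fun i j => Disjoint (m.degree (f i)) (m.degree (f j)))
    (hsq : ∀ i s, m.degree (f i) s ≤ 1) (S : Finset ι) : (Ideal.span (f '' S)).IsRadical := by
  rintro g ⟨n, hn⟩
  obtain ⟨r, hgr, hr⟩ := m.exists_sub_mem_span_image hf S g
  rcases eq_or_ne r 0 with rfl | hr0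
  · simpa using hgr
  have hrn : r ^ n ∈ Ideal.span (f '' S) := by
    have := sub_mem hn (Ideal.mem_of_dvd _ (sub_dvd_pow_sub_pow g r n) hgr)
    rwa [sub_sub_cancel] at this
  obtain ⟨i, hi, hle⟩ := m.exists_degree_le_of_mem_span_image hf hd S hrn (pow_ne_zero n hr0)
  rw [m.degree_pow] at hle
  refine absurd (fun s => ?_) (hr _ (m.degree_mem_support hr0) i hi)
  have h1 := hle s
  have h2 := hsq i s
  rw [Finsupp.smul_apply, smul_eq_mul] at h1
  rcases Nat.eq_zero_or_pos (m.degree r s) with h0 | h0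
  · rwa [h0, mul_zero, ← h0] at h1
  · omega

theorem span_image_ne_top (hf : ∀ i, f i ≠ 0)
    (hd : Pairwise fun i j => Disjoint (m.degree (f i)) (m.degree (f j)))
    (h0 : ∀ i, m.degree (f i) ≠ 0) (S : Finset ι) : Ideal.span (f '' S) ≠ ⊤ := by
  intro h
  obtain ⟨i, -, hle⟩ := m.exists_degree_le_of_mem_span_image hf hd S
    ((Ideal.eq_top_iff_one _).1 h) one_ne_zero
  rw [m.degree_one] at hle
  exact h0 i (nonpos_iff_eq_zero.1 hle)

/-- Krull's height theorem bounds the height by the number of generators, and regularity of the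
generators gives the reverse inequality. -/
theorem spanFinrank_span_image_eq_height [Finite σ] (hf : ∀ i, f i ≠ 0)
    (hd : Pairwise fun i j => Disjoint (m.degree (f i)) (m.degree (f j)))
    (h0 : ∀ i, m.degree (f i) ≠ 0) (S : Finset ι) :
    (Submodule.spanFinrank (Ideal.span (f '' S)) : ℕ∞) = (Ideal.span (f '' S)).height := by
  classical
  refine le_antisymm ?_ (Ideal.height_le_spanFinrank _ (m.span_image_ne_top hf hd h0 S))
  refine le_trans ?_ (m.card_le_height_span_image hf hd S)
  refine (Submodule.spanFinrank_span_le_encard _).trans ((Set.encard_image_le _ _).trans ?_)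
  rw [Set.encard_coe_eq_coe_finsetCard]

end Field

/-- A polynomial all of whose monomials other than `M` are smaller than `M`, and in which `M`
occurs, has leading monomial `M`. -/
theorem degree_eq_of_forall_mem_support {σ R : Type*} [CommSemiring R] (m : MonomialOrder σ)
    {f : MvPolynomial σ R} {M : σ →₀ ℕ} (hM : M ∈ f.support)
    (h : ∀ c ∈ f.support, c ≠ M → m.toSyn c < m.toSyn M) : m.degree f = M := by
  apply m.toSyn.injective
  refine le_antisymm (m.degree_le_iff.2 fun c hc => ?_) (m.le_degree hM)
  rcases eq_or_ne c M with rfl | hne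
  · exact le_rfl
  · exact (h c hc hne).le

/-! ### Monomial orders refining a weight -/

/-- An arbitrary monomial order on finitely many variables: the lexicographic one for some ordering
of the variables. -/
noncomputable def ofFinite (σ : Type*) [Finite σ] : MonomialOrder σ :=
  letI : LinearOrder σ := LinearOrder.lift' (Finite.equivFin σ) (Finite.equivFin σ).injective
  MonomialOrder.lex

section Weighted

variable {σ N : Type*} [AddCommGroup N]
  (m : MonomialOrder σ) (W : σ → N)

/-- The key by which monomials are compared in `MonomialOrder.degWeighted`: the total degree, then
the weight, then the given order. -/
noncomputable def degWeightedKey : (σ →₀ ℕ) →+ ℕ ×ₗ (N ×ₗ m.syn) where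
  toFun a := toLex (a.degree, toLex (Finsupp.weight W a, m.toSyn a))
  map_zero' := by simp
  map_add' a b := by simp; rfl

theorem degWeightedKey_injective : Function.Injective (m.degWeightedKey W) := by
  intro a b h
  have := congrArg (fun x => (ofLex (ofLex x).2).2) h
  exact m.toSyn.injective this

theorem degWeightedKey_monotone [LinearOrder N] : Monotone (m.degWeightedKey W) := by
  intro a b hab
  obtain ⟨c, rfl⟩ := exists_add_of_le hab
  rcases eq_or_ne c 0 with rfl | hc
  · simp
  · refine le_of_lt (Prod.Lex.toLex_lt_toLex.2 (Or.inl ?_))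
    have : c.degree ≠ 0 := fun h => hc ((Finsupp.degree_eq_zero_iff c).1 h)
    simp only [map_add]
    omega

/-- The monomial order comparing total degrees first, then weights in an ordered group, and
finally breaking ties by `m`. Since the total degree comes first, the weights of the variables may
be negative. -/
noncomputable def degWeighted [Finite σ] [LinearOrder N] [IsOrderedAddMonoid N] : MonomialOrder σ where
  syn := AddMonoidHom.mrange (m.degWeightedKey W)
  addCommMonoidSyn := AddSubmonoid.toAddCommMonoid _
  toSyn :=
    { Equiv.ofBijective (m.degWeightedKey W).mrangeRestrict
        ⟨fun _ _ h => m.degWeightedKey_injective W (congrArg Subtype.val h),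
          (m.degWeightedKey W).mrangeRestrict_surjective⟩ with
      map_add' := fun a b => Subtype.ext (map_add (m.degWeightedKey W) a b) }
  toSyn_monotone := fun _ _ h => m.degWeightedKey_monotone W h
  wellFoundedLT_syn := by
    -- By Dickson's lemma, the divisibility order on monomials is a well-quasi-order.
    have : WellQuasiOrderedLE (AddMonoidHom.mrange (m.degWeightedKey W)) := ⟨fun u => by
      choose v hv using fun i => (u i).2
      obtain ⟨i, j, hij, hle⟩ := wellQuasiOrdered_le v
      refine ⟨i, j, hij, ?_⟩
      change (u i : ℕ ×ₗ (N ×ₗ m.syn)) ≤ u j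
      rw [← hv i, ← hv j]
      exact m.degWeightedKey_monotone W hle⟩
    infer_instance

theorem degWeighted_lt [Finite σ] [LinearOrder N] [IsOrderedAddMonoid N]
    {a b : σ →₀ ℕ} (hdeg : a.degree = b.degree)
    (hW : Finsupp.weight W a < Finsupp.weight W b) :
    (m.degWeighted W).toSyn a < (m.degWeighted W).toSyn b :=
  Prod.Lex.toLex_lt_toLex.2 (Or.inr ⟨hdeg, Prod.Lex.toLex_lt_toLex.2 (Or.inl hW)⟩)

end Weighted

end MonomialOrder

namespace TwistedLSS

open MvPolynomial

variable {n d p : ℕ}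

/-! ### The monomials of the generators -/

/-- The exponent of the monomial `x_{i,2l-1} x_{j,2l}`. -/
noncomputable def pairExponent (i j : Fin n) (l : Fin d) : (Fin n × Fin (2 * d)) →₀ ℕ :=
  Finsupp.single (i, oddIdx l) 1 + Finsupp.single (j, evenIdx l) 1

theorem oddIdx_ne_evenIdx (l m : Fin d) : oddIdx l ≠ evenIdx m := by
  intro h
  have := congrArg Fin.val h
  simp only [oddIdx, evenIdx] at this
  omega

theorem oddIdx_inj {l m : Fin d} : oddIdx l = oddIdx m ↔ l = m := by
  simp [oddIdx, Fin.ext_iff]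

theorem evenIdx_inj {l m : Fin d} : evenIdx l = evenIdx m ↔ l = m := by
  simp [evenIdx, Fin.ext_iff]

theorem pairExponent_oddIdx (i j a : Fin n) (l m : Fin d) :
    pairExponent i j l (a, oddIdx m) = if i = a ∧ l = m then 1 else 0 := by
  simp [pairExponent, Finsupp.single_apply, oddIdx_inj, (oddIdx_ne_evenIdx _ _).symm]

theorem pairExponent_evenIdx (i j a : Fin n) (l m : Fin d) :
    pairExponent i j l (a, evenIdx m) = if j = a ∧ l = m then 1 else 0 := by
  simp [pairExponent, Finsupp.single_apply, evenIdx_inj, oddIdx_ne_evenIdx]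

theorem exists_eq_oddIdx_or_eq_evenIdx (c : Fin (2 * d)) :
    ∃ l : Fin d, c = oddIdx l ∨ c = evenIdx l := by
  refine ⟨⟨c / 2, by omega⟩, ?_⟩
  simp only [oddIdx, evenIdx, Fin.ext_iff]
  omega

theorem pairExponent_inj {i j a b : Fin n} {l m : Fin d} :
    pairExponent i j l = pairExponent a b m ↔ i = a ∧ j = b ∧ l = m := by
  refine ⟨fun h => ?_, by rintro ⟨rfl, rfl, rfl⟩; rfl⟩
  have h1 := DFunLike.congr_fun h (a, oddIdx m)
  have h2 := DFunLike.congr_fun h (b, evenIdx m)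
  simp only [pairExponent_oddIdx, pairExponent_evenIdx, and_self, if_true] at h1 h2
  simp only [ite_eq_left_iff, zero_ne_one, imp_false, not_not] at h1 h2
  exact ⟨h1.1, h2.1, h1.2⟩

theorem pairExponent_apply_le_one (i j : Fin n) (l : Fin d) (s : Fin n × Fin (2 * d)) :
    pairExponent i j l s ≤ 1 := by
  obtain ⟨a, c⟩ := s
  obtain ⟨m, rfl | rfl⟩ := exists_eq_oddIdx_or_eq_evenIdx c
  · rw [pairExponent_oddIdx]; split_ifs <;> simp
  · rw [pairExponent_evenIdx]; split_ifs <;> simp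

theorem pairExponent_ne_zero (i j : Fin n) (l : Fin d) : pairExponent i j l ≠ 0 := by
  intro h
  have := DFunLike.congr_fun h (i, oddIdx l)
  simp [pairExponent_oddIdx] at this

theorem degree_pairExponent (i j : Fin n) (l : Fin d) : (pairExponent i j l).degree = 2 := by
  simp [pairExponent]

theorem disjoint_pairExponent {i j a b : Fin n} {l m : Fin d}
    (h : l = m → i ≠ a ∧ j ≠ b) : Disjoint (pairExponent i j l) (pairExponent a b m) := by
  rw [_root_.disjoint_iff]
  ext ⟨x, c⟩
  obtain ⟨r, rfl | rfl⟩ := exists_eq_oddIdx_or_eq_evenIdx c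
  · simp only [Finsupp.inf_apply, pairExponent_oddIdx, _root_.bot_eq_zero, Finsupp.zero_apply]
    split_ifs with h1 h2 <;> try rfl
    exact absurd (h1.1.trans h2.1.symm) (h (h1.2.trans h2.2.symm)).1
  · simp only [Finsupp.inf_apply, pairExponent_evenIdx, _root_.bot_eq_zero, Finsupp.zero_apply]
    split_ifs with h1 h2 <;> try rfl
    exact absurd (h1.1.trans h2.1.symm) (h (h1.2.trans h2.2.symm)).2

section Field

variable (k : Type*) [Field k]

theorem twistedGen_eq_sum_monomial (i j : Fin n) :
    twistedGen k d i j =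
      ∑ l : Fin d, (monomial (pairExponent i j l) 1 - monomial (pairExponent j i l) 1) := by
  refine Finset.sum_congr rfl fun l _ => ?_
  rw [mul_comm (X (i, evenIdx l))]
  simp only [pairExponent, X, monomial_mul, mul_one]

theorem twistedGen_swap (i j : Fin n) : twistedGen k d j i = -twistedGen k d i j := by
  simp only [twistedGen_eq_sum_monomial, ← Finset.sum_neg_distrib, neg_sub]

theorem exists_eq_pairExponent_of_mem_support {i j : Fin n} {c : (Fin n × Fin (2 * d)) →₀ ℕ}
    (hc : c ∈ (twistedGen k d i j).support) :
    ∃ l : Fin d, c = pairExponent i j l ∨ c = pairExponent j i l := by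
  classical
  by_contra! h
  refine (mem_support_iff.1 hc) ?_
  rw [twistedGen_eq_sum_monomial, coeff_sum]
  refine Finset.sum_eq_zero fun l _ => ?_
  rw [coeff_sub, coeff_monomial, coeff_monomial, if_neg (h l).1.symm, if_neg (h l).2.symm, sub_zero]

theorem pairExponent_mem_support {i j : Fin n} (hij : i ≠ j) (l : Fin d) :
    pairExponent i j l ∈ (twistedGen k d i j).support := by
  classical
  rw [mem_support_iff, twistedGen_eq_sum_monomial, coeff_sum, Finset.sum_eq_single l]
  · simp [coeff_sub, coeff_monomial, pairExponent_inj, hij.symm]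
  · intro m _ hm
    simp [coeff_sub, coeff_monomial, pairExponent_inj, hij.symm, hm]
  · simp

end Field

/-! ### Leading monomials from a twisted positive matching decomposition -/

section Decomposition

variable {G : SimpleGraph (Fin n)} {M : Fin (2 * p) → Set (Sym2 (Fin n))}

theorem IsTwistedMatchingDecomposition.mem_edgeSet (hM : IsTwistedMatchingDecomposition G M)
    {l : Fin (2 * p)} {e : Sym2 (Fin n)} (he : e ∈ M l) : e ∈ G.edgeSet :=
  hM.union ▸ Set.mem_iUnion_of_mem l he

theorem IsTwistedMatchingDecomposition.eq_of_mem_of_mem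
    (hM : IsTwistedMatchingDecomposition G M) {l m : Fin (2 * p)} {e : Sym2 (Fin n)}
    (hl : e ∈ M l) (hm : e ∈ M m) : l = m := by
  by_contra h
  exact Set.disjoint_left.1 (hM.disjoint l m h) hl hm

theorem IsTwistedMatchingDecomposition.right_unique (hM : IsTwistedMatchingDecomposition G M)
    {l : Fin (2 * p)} {a b c : Fin n} (hb : s(a, b) ∈ M l) (hc : s(a, c) ∈ M l) : b = c := by
  by_contra h
  exact hM.matching l hb hc (fun he => h (Sym2.congr_right.1 he)) a (by simp) (by simp)

theorem exists_mem_of_adj {q : Fin p} {a b : Fin n}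
    (h : (pairGraph M q).Adj (Sum.inl a) (Sum.inr b)) :
    ∃ l, (l = oddIdx q ∨ l = evenIdx q) ∧ s(a, b) ∈ M l := by
  rw [pairGraph_adj_inl_inr] at h
  rcases h with ⟨-, h⟩ | ⟨-, h⟩
  exacts [⟨_, Or.inl rfl, h⟩, ⟨_, Or.inr rfl, h⟩]

theorem IsTwistedMatchingDecomposition.ne_of_adj (hM : IsTwistedMatchingDecomposition G M)
    {q : Fin p} {a b : Fin n} (h : (pairGraph M q).Adj (Sum.inl a) (Sum.inr b)) : a ≠ b := by
  obtain ⟨l, -, hl⟩ := exists_mem_of_adj h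
  exact (hM.mem_edgeSet hl).ne

/-- In `H_q` the vertices `i_{2q-1}` have degree at most one: the matching property excludes two
edges from the same matching, the twisted condition excludes one edge from each. -/
theorem IsTwistedMatchingDecomposition.adj_right_unique
    (hM : IsTwistedMatchingDecomposition G M) {q : Fin p} {a b c : Fin n}
    (hb : (pairGraph M q).Adj (Sum.inl a) (Sum.inr b))
    (hc : (pairGraph M q).Adj (Sum.inl a) (Sum.inr c)) : b = c := by
  rw [pairGraph_adj_inl_inr] at hb hc
  rcases hb with ⟨hab, hb⟩ | ⟨hba, hb⟩ <;> rcases hc with ⟨hac, hc⟩ | ⟨hca, hc⟩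
  · exact hM.right_unique hb hc
  · exact absurd (Sym2.eq_swap ▸ hc) ((hM.twisted q a b hab hb).1 c hca)
  · exact absurd (Sym2.eq_swap ▸ hb) ((hM.twisted q a c hac hc).1 b hba)
  · exact hM.right_unique hb hc

/-- In `H_q` the vertices `i_{2q}` have degree at most one. -/
theorem IsTwistedMatchingDecomposition.adj_left_unique
    (hM : IsTwistedMatchingDecomposition G M) {q : Fin p} {a b c : Fin n}
    (hb : (pairGraph M q).Adj (Sum.inl b) (Sum.inr a))
    (hc : (pairGraph M q).Adj (Sum.inl c) (Sum.inr a)) : b = c := by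
  rw [pairGraph_adj_inl_inr] at hb hc
  rw [Sym2.eq_swap] at hb hc
  rcases hb with ⟨hab, hb⟩ | ⟨hba, hb⟩ <;> rcases hc with ⟨hac, hc⟩ | ⟨hca, hc⟩
  · exact hM.right_unique hb hc
  · exact absurd hc ((hM.twisted q b a hab (Sym2.eq_swap ▸ hb)).2 c hca)
  · exact absurd hb ((hM.twisted q c a hac (Sym2.eq_swap ▸ hc)).2 b hba)
  · exact hM.right_unique hb hc

/-- The weight vector of a variable: its `q`-th entry is the value of the `q`-th mapping `w q` on
the vertex `i_{2q-1}` for `x_{i,2q-1}`, on `i_{2q}` for `x_{i,2q}`, and `0` for variables of the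
other columns. Weight vectors are compared lexicographically. -/
def variableWeight (d : ℕ) (w : Fin p → Fin n ⊕ Fin n → ℝ) (s : Fin n × Fin (2 * d)) :
    Lex (Fin p → ℝ) :=
  toLex fun q => if (s.2 : ℕ) = 2 * q then w q (Sum.inl s.1)
    else if (s.2 : ℕ) = 2 * q + 1 then w q (Sum.inr s.1) else 0

theorem weight_pairExponent (w : Fin p → Fin n ⊕ Fin n → ℝ) (i j : Fin n) (l : Fin d)
    (q : Fin p) : ofLex (Finsupp.weight (variableWeight d w) (pairExponent i j l)) q =
      if (l : ℕ) = q then w q (Sum.inl i) + w q (Sum.inr j) else 0 := by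
  have h : Finsupp.weight (variableWeight d w) (pairExponent i j l) =
      variableWeight d w (i, oddIdx l) + variableWeight d w (j, evenIdx l) := by
    simp [pairExponent, Finsupp.weight_single]
  rw [h]
  change (ofLex (variableWeight d w (i, oddIdx l))) q +
    (ofLex (variableWeight d w (j, evenIdx l))) q = _
  have h1 : 2 * (l : ℕ) ≠ 2 * q + 1 := by omega
  have h2 : 2 * (l : ℕ) + 1 ≠ 2 * q := by omega
  by_cases hl : (l : ℕ) = q
  · simp [variableWeight, oddIdx, evenIdx, hl]
  · simp [variableWeight, oddIdx, evenIdx, hl, h1, h2]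

/-- Monomials from the columns of the `q`-th or later pairs have zero weight before the `q`-th
entry, so that a strict inequality there decides. -/
theorem weight_pairExponent_lt_of_le {w : Fin p → Fin n ⊕ Fin n → ℝ} {i j a b : Fin n}
    {l m : Fin d} (q : Fin p) (hl : (q : ℕ) ≤ l) (hm : (q : ℕ) ≤ m)
    (h : (if (l : ℕ) = q then w q (Sum.inl i) + w q (Sum.inr j) else 0) <
      if (m : ℕ) = q then w q (Sum.inl a) + w q (Sum.inr b) else 0) :
    Finsupp.weight (variableWeight d w) (pairExponent i j l) <
      Finsupp.weight (variableWeight d w) (pairExponent a b m) := by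
  refine ⟨q, fun r hr => ?_, ?_⟩
  · have hr' : (r : ℕ) < q := hr
    refine (weight_pairExponent w i j l r).trans (Eq.trans ?_ (weight_pairExponent w a b m r).symm)
    rw [if_neg (by omega), if_neg (by omega)]
  · exact (weight_pairExponent w i j l q).trans_lt
      (h.trans_eq (weight_pairExponent w a b m q).symm)

/-- For an edge `{a, b}` of the `q`-th pair of matchings, the monomial `x_{a,2q-1} x_{b,2q}` is
the heaviest one of the generator of `{a, b}`. A monomial from the columns of an earlier pair `l`
has negative `l`-th weight, one from the columns of a later pair has zero `q`-th weight. -/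
theorem weight_pairExponent_lt (hM : IsTwistedMatchingDecomposition G M)
    {w : Fin p → Fin n ⊕ Fin n → ℝ} (hw : ∀ q, IsTwistedPositiveMapping G M q (w q))
    (hpd : p ≤ d) {q : Fin p} {a b : Fin n}
    (hab : (pairGraph M q).Adj (Sum.inl a) (Sum.inr b)) {i j : Fin n} {l : Fin d}
    (hij : i = a ∧ j = b ∨ i = b ∧ j = a)
    (hne : pairExponent i j l ≠ pairExponent a b (Fin.castLE hpd q)) :
    Finsupp.weight (variableWeight d w) (pairExponent i j l) <
      Finsupp.weight (variableWeight d w) (pairExponent a b (Fin.castLE hpd q)) := by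
  have hane : a ≠ b := hM.ne_of_adj hab
  have hpos := (hw q).pos a b hane hab
  obtain ⟨m, hm, hmem⟩ := exists_mem_of_adj hab
  rcases lt_trichotomy (l : ℕ) q with hlt | heq | hgt
  · obtain ⟨r, hr⟩ : ∃ r : Fin p, (r : ℕ) = l := ⟨⟨l, by omega⟩, rfl⟩
    refine weight_pairExponent_lt_of_le r hr.le (by rw [Fin.val_castLE]; omega) ?_
    rw [if_pos hr.symm, if_neg (by rw [Fin.val_castLE]; omega)]
    have hnot : ∀ m', s(a, b) ∈ M m' → ¬ ((m' : ℕ) ≤ 2 * r + 1) := by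
      intro m' hm' hle
      obtain rfl := hM.eq_of_mem_of_mem hmem hm'
      rcases hm with rfl | rfl <;> simp only [oddIdx, evenIdx] at hle <;> omega
    have hadj : ∀ x y, s(x, y) = s(a, b) → ¬ (pairGraph M r).Adj (Sum.inl x) (Sum.inr y) := by
      intro x y hxy h
      obtain ⟨m', hm', hmem'⟩ := exists_mem_of_adj h
      refine hnot m' (hxy ▸ hmem') ?_
      rcases hm' with rfl | rfl <;> simp [oddIdx, evenIdx]
    have hneg := (hw r).neg a b hane (hM.mem_edgeSet hmem)
      (fun m' hm' h => hnot m' h (by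
        have : (m' : ℕ) < 2 * r := hm'
        omega))
      (hadj a b rfl) (hadj b a Sym2.eq_swap)
    rcases hij with ⟨rfl, rfl⟩ | ⟨rfl, rfl⟩
    exacts [hneg.1, hneg.2]
  · have hl : l = Fin.castLE hpd q := Fin.ext heq
    rcases hij with ⟨rfl, rfl⟩ | ⟨rfl, rfl⟩
    · exact absurd (by rw [hl]) hne
    · refine weight_pairExponent_lt_of_le q heq.ge le_rfl ?_
      rw [if_pos heq, if_pos (Fin.val_castLE _ _)]
      exact hpos.2.trans hpos.1
  · refine weight_pairExponent_lt_of_le q hgt.le le_rfl ?_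
    rw [if_neg (by omega), if_pos (Fin.val_castLE _ _)]
    exact hpos.1

/-- The monomial order in which every generator has the leading monomial marked by the
decomposition. The tie-breaker `MonomialOrder.ofFinite` is an arbitrary choice. -/
noncomputable def decompositionOrder (d : ℕ) (w : Fin p → Fin n ⊕ Fin n → ℝ) :
    MonomialOrder (Fin n × Fin (2 * d)) :=
  (MonomialOrder.ofFinite _).degWeighted (variableWeight d w)

theorem degree_twistedGen (k : Type*) [Field k] (hM : IsTwistedMatchingDecomposition G M)
    {w : Fin p → Fin n ⊕ Fin n → ℝ} (hw : ∀ q, IsTwistedPositiveMapping G M q (w q))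
    (hpd : p ≤ d) {q : Fin p} {a b : Fin n}
    (hab : (pairGraph M q).Adj (Sum.inl a) (Sum.inr b)) :
    (decompositionOrder d w).degree (twistedGen k d a b) =
      pairExponent a b (Fin.castLE hpd q) := by
  refine MonomialOrder.degree_eq_of_forall_mem_support _
    (pairExponent_mem_support k (hM.ne_of_adj hab) _) fun c hc hne => ?_
  obtain ⟨l, rfl | rfl⟩ := exists_eq_pairExponent_of_mem_support k hc
  all_goals
    refine MonomialOrder.degWeighted_lt _ _ ((degree_pairExponent _ _ _).trans (degree_pairExponent _ _ _).symm) ?_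
    exact weight_pairExponent_lt hM hw hpd hab (by simp) hne

/-- The edges of all the graphs `H_q`: the triple `(i, j, q)` is the edge `{i_{2q-1}, j_{2q}}` of
`H_q`. They correspond to the edges of `G`, each one oriented so that its generator contains the
marked monomial with coefficient `1`. -/
abbrev PairEdge (M : Fin (2 * p) → Set (Sym2 (Fin n))) : Type :=
  {t : Fin n × Fin n × Fin p // (pairGraph M t.2.2).Adj (Sum.inl t.1) (Sum.inr t.2.1)}

theorem twistedLSSIdeal_eq_span_range (k : Type*) [Field k]
    (hM : IsTwistedMatchingDecomposition G M) :
    twistedLSSIdeal k G d = Ideal.span (Set.range fun t : PairEdge M => twistedGen k d t.1.1 t.1.2.1) := by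
  apply le_antisymm
  · refine Ideal.span_le.2 ?_
    rintro _ ⟨i, j, hij, hadj, rfl⟩
    obtain ⟨c, hc⟩ := Set.mem_iUnion.1 (hM.union.symm ▸ (G.mem_edgeSet.2 hadj) : _ ∈ ⋃ l, M l)
    obtain ⟨q, rfl | rfl⟩ := exists_eq_oddIdx_or_eq_evenIdx c
    · exact Ideal.subset_span
        ⟨⟨(i, j, q), (pairGraph_adj_inl_inr M q i j).2 (Or.inl ⟨hij, hc⟩)⟩, rfl⟩
    · rw [SetLike.mem_coe, ← neg_neg (twistedGen k d i j), ← twistedGen_swap]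
      exact neg_mem (Ideal.subset_span
        ⟨⟨(j, i, q), (pairGraph_adj_inl_inr M q j i).2 (Or.inr ⟨hij, Sym2.eq_swap ▸ hc⟩)⟩, rfl⟩)
  · refine Ideal.span_le.2 ?_
    rintro _ ⟨⟨⟨a, b, q⟩, hab⟩, rfl⟩
    obtain ⟨l, -, hl⟩ := exists_mem_of_adj hab
    have hadj : G.Adj a b := hM.mem_edgeSet hl
    rcases lt_or_gt_of_ne hadj.ne with hlt | hlt
    · exact Ideal.subset_span ⟨a, b, hlt, hadj, rfl⟩
    · change twistedGen k d a b ∈ _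
      rw [twistedGen_swap]
      exact neg_mem (Ideal.subset_span ⟨b, a, hlt, hadj.symm, rfl⟩)

/-- A graph with a twisted positive matching decomposition into at most `d` pairs has a radical
complete intersection twisted Lovász-Saks-Schrijver ideal. -/
theorem isRadical_and_isCompleteIntersection_of_admits (k : Type*) [Field k]
    (h : AdmitsTPMDecomposition G p) (hpd : p ≤ d) :
    (twistedLSSIdeal k G d).IsRadical ∧ IsCompleteIntersection (twistedLSSIdeal k G d) := by
  classical
  obtain ⟨M, hM, hw⟩ := h
  choose w hw using hw
  let f : PairEdge M → MvPolynomial (Fin n × Fin (2 * d)) k := fun t => twistedGen k d t.1.1 t.1.2.1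
  have hdeg : ∀ t, (decompositionOrder d w).degree (f t) =
      pairExponent t.1.1 t.1.2.1 (Fin.castLE hpd t.1.2.2) :=
    fun t => degree_twistedGen k hM hw hpd t.2
  have h0 : ∀ t, (decompositionOrder d w).degree (f t) ≠ 0 := fun t => by
    rw [hdeg]; exact pairExponent_ne_zero _ _ _
  have hf : ∀ t, f t ≠ 0 := fun t => MonomialOrder.ne_zero_of_degree_ne_zero (h0 t)
  have hd : Pairwise fun s t => Disjoint ((decompositionOrder d w).degree (f s))
      ((decompositionOrder d w).degree (f t)) := by
    rintro ⟨⟨a, b, q⟩, hab⟩ ⟨⟨a', b', q'⟩, hab'⟩ hne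
    simp only [hdeg]
    refine disjoint_pairExponent fun hq => ?_
    obtain rfl : q = q' := Fin.castLE_injective hpd hq
    refine ⟨?_, ?_⟩
    · rintro rfl
      obtain rfl := hM.adj_right_unique hab hab'
      exact hne rfl
    · rintro rfl
      obtain rfl := hM.adj_left_unique hab hab'
      exact hne rfl
  have hI : twistedLSSIdeal k G d = Ideal.span (f '' (Finset.univ : Finset (PairEdge M))) := by
    rw [Finset.coe_univ, Set.image_univ]
    exact twistedLSSIdeal_eq_span_range k hM
  rw [hI]
  refine ⟨(decompositionOrder d w).isRadical_span_image hf hd (fun t s => ?_) _,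
    IsNoetherian.noetherian _,
    (decompositionOrder d w).spanFinrank_span_image_eq_height hf hd h0 _⟩
  rw [hdeg]
  exact pairExponent_apply_le_one _ _ _ _

end Decomposition

end TwistedLSS

theorem mainTheorem2 (k : Type*) [Field k] (n : ℕ) (G : SimpleGraph (Fin n)) (d : ℕ)
    (hd : TwistedLSS.tpmd G ≤ d) :
    (TwistedLSS.twistedLSSIdeal k G d).IsRadical ∧
      TwistedLSS.IsCompleteIntersection (TwistedLSS.twistedLSSIdeal k G d) :=
  TwistedLSS.isRadical_and_isCompleteIntersection_of_admits k
    (Nat.sInf_mem (TwistedLSS.exists_admitsTPMDecomposition G)).2 hd
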